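/- All graphs are finite, simple and connected. Let $d(u,v)$ denote the distance between the vertices $u$ and $v$ of a graph $G$. Two vertices $u,v$ of $G$ are doubly resolved by vertices $x,y$ if $d(v,x)-d(u,x)\neq d(v,y)-d(u,y)$. A set $W\subseteq V(G)$ is a doubly resolving set for $G$ if every two distinct vertices of $G$ are doubly resolved by some two vertices of $W$; the doubly resolving number $\psi(G)$ is the minimum cardinality of a doubly resolving set for $G$. A leaf is a vertex of degree $1$, and $l(G)$ denotes the number of leaves of $G$. A graph is unicyclic if it contains exactly one cycle (as a subgraph). Theorem. Let $G$ be a finite, simple, connected unicyclic graph that is not itself a cycle, and let $m$ be the number of vertices of its unique cycle. Then $$l(G)\le \psi(G)\le \begin{cases} l(G)+1 & \text{if } m \text{ is odd},\\ l(G)+2 & \text{if } m \text{ is even}.\end{cases}$$ -/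

import Mathlib

namespace SimpleGraph

/-- A subgraph is a cycle if it consists of exactly the vertices and edges traversed by some
closed walk that is a cycle (length at least `3`, no repeated edge, no repeated vertex except that
the endpoints agree). -/
def Subgraph.IsCycleSubgraph {V : Type*} {G : SimpleGraph V} (C : G.Subgraph) : Prop :=
  ∃ (v : V) (p : G.Walk v v), p.IsCycle ∧ p.toSubgraph = C

/-- A graph is a cycle if, as a subgraph of itself, it is a cycle. -/
def IsCycleGraph {V : Type*} (G : SimpleGraph V) : Prop :=
  (⊤ : G.Subgraph).IsCycleSubgraph

/-- A unicyclic graph: exactly one subgraph is a cycle. -/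
def IsUnicyclic {V : Type*} (G : SimpleGraph V) : Prop :=
  ∃! C : G.Subgraph, C.IsCycleSubgraph

/-- The vertices `u, v` are doubly resolved by the vertices `x, y`. -/
def DoublyResolved {V : Type*} (G : SimpleGraph V) (u v x y : V) : Prop :=
  (G.dist v x : ℤ) - (G.dist u x : ℤ) ≠ (G.dist v y : ℤ) - (G.dist u y : ℤ)

/-- `W` is a doubly resolving set for `G`. -/
def IsDoublyResolvingSet {V : Type*} (G : SimpleGraph V) (W : Finset V) : Prop :=
  ∀ u v : V, u ≠ v → ∃ x ∈ W, ∃ y ∈ W, G.DoublyResolved u v x y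

/-- The doubly resolving number: the minimum cardinality of a doubly resolving set. -/
noncomputable def doublyResolvingNumber {V : Type*} (G : SimpleGraph V) : ℕ :=
  sInf {k : ℕ | ∃ W : Finset V, G.IsDoublyResolvingSet W ∧ W.card = k}

/-- The set of leaves, that is, of vertices of degree `1`. -/
def leafFinset {V : Type*} [Fintype V] (G : SimpleGraph V) [DecidableRel G.Adj] : Finset V :=
  {v : V | G.degree v = 1}

/-- In a finite connected graph the set of all vertices is doubly resolving, so the minimum in the
definition of the doubly resolving number is over a nonempty set. -/
theorem Connected.isDoublyResolvingSet_univ {V : Type*} [Fintype V] {G : SimpleGraph V}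
    (hG : G.Connected) : G.IsDoublyResolvingSet Finset.univ := by
  intro u v huv
  refine ⟨u, Finset.mem_univ u, v, Finset.mem_univ v, ?_⟩
  have h := hG.pos_dist_of_ne huv
  have h' : G.dist v u = G.dist u v := dist_comm
  simp only [DoublyResolved, dist_self, h']
  omega

/-- In a finite connected graph the doubly resolving number is attained. -/
theorem Connected.exists_card_eq_doublyResolvingNumber {V : Type*} [Fintype V]
    {G : SimpleGraph V} (hG : G.Connected) :
    ∃ W : Finset V, G.IsDoublyResolvingSet W ∧ W.card = G.doublyResolvingNumber :=
  Nat.sInf_mem (s := {k : ℕ | ∃ W : Finset V, G.IsDoublyResolvingSet W ∧ W.card = k})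
    ⟨_, Finset.univ, hG.isDoublyResolvingSet_univ, rfl⟩

end SimpleGraph

namespace SimpleGraph

/-! Lower bound: a leaf and its neighbour are resolved only with the help of the leaf, so every
doubly resolving set contains all leaves (`IsDoublyResolvingSet.mem_of_degree_eq_one`).

Upper bound: prune leaves one at a time (`Connected.exists_isDoublyResolvingSet_union`). When `l` is
removed, its neighbour stands in for it; on the remaining vertices the two distance functions differ
by a constant, which cancels in double resolution. Pruning ends at the bare cycle, where the
stand-in of some leaf is one free landmark and one more (odd `m`) or two more (even `m`) suffice.
The bound `S.card + m % 2 ≤ 2` covers both parities. The induction replaces unicyclicity by equality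
of the numbers of edges and vertices, which pruning preserves. -/

/-! ### Leaves and distances -/

/-- Distances from a leaf are measured through its unique neighbour. -/
theorem Connected.dist_leaf {V : Type*} {G : SimpleGraph V} (hG : G.Connected) {l p : V}
    (hp : G.Adj l p) (huniq : ∀ q, G.Adj l q → q = p) {z : V} (hz : z ≠ l) :
    G.dist l z = G.dist p z + 1 := by
  obtain ⟨w, hw⟩ := hG.exists_walk_length_eq_dist l z
  cases w with
  | nil => exact absurd rfl hz
  | @cons _ q _ h w =>
    obtain rfl := huniq q h
    have h1 := dist_le w
    have h2 := hG.dist_triangle (u := l) (v := q) (w := z)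
    rw [dist_eq_one_iff_adj.mpr h] at h2
    rw [Walk.length_cons] at hw
    omega

/-- A doubly resolving set contains every leaf. -/
theorem IsDoublyResolvingSet.mem_of_degree_eq_one {V : Type*} {G : SimpleGraph V}
    (hG : G.Connected) {W : Finset V} (hW : G.IsDoublyResolvingSet W) {l : V}
    [Fintype (G.neighborSet l)] (hl : G.degree l = 1) : l ∈ W := by
  obtain ⟨p, hp, huniq⟩ := degree_eq_one_iff_existsUnique_adj.mp hl
  by_contra hlW
  -- Every vertex other than `l` sees `l` exactly one step further away than `p`.
  obtain ⟨x, hx, y, hy, hxy⟩ := hW l p hp.ne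
  have hx' := hG.dist_leaf hp huniq (z := x) (by rintro rfl; exact hlW hx)
  have hy' := hG.dist_leaf hp huniq (z := y) (by rintro rfl; exact hlW hy)
  unfold DoublyResolved at hxy
  omega

/-- Removing a leaf does not change distances. -/
theorem Connected.dist_induce_compl_leaf {V : Type*} {G : SimpleGraph V} (hG : G.Connected)
    {l p : V} (hp : G.Adj l p) (huniq : ∀ q, G.Adj l q → q = p)
    (hG' : (G.induce {l}ᶜ).Connected) (u v : ({l}ᶜ : Set V)) :
    (G.induce {l}ᶜ).dist u v = G.dist u v := by
  apply le_antisymm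
  · induction h : G.dist u v generalizing u with
    | zero =>
      obtain rfl : u = v := Subtype.ext (hG.dist_eq_zero_iff.mp h)
      simp
    | succ n ih =>
      obtain ⟨w, hw⟩ := hG.exists_walk_length_eq_dist (u : V) v
      obtain ⟨u, hu⟩ := u
      dsimp only at w hw h
      cases w with
      | nil => simp at h
      | @cons _ q _ hq w =>
        have h1 := dist_le w
        have h2 := hG.dist_triangle (u := u) (v := q) (w := v)
        rw [dist_eq_one_iff_adj.mpr hq] at h2
        rw [Walk.length_cons] at hw
        by_cases hql : q = l
        · subst hql
          obtain rfl := huniq u hq.symm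
          have := hG.dist_leaf hp huniq v.2
          omega
        · have h3 := ih ⟨q, hql⟩ (by dsimp only; omega)
          have h4 := hG'.dist_triangle (u := ⟨u, hu⟩) (v := ⟨q, hql⟩) (w := v)
          have h5 : (G.induce {l}ᶜ).dist ⟨u, hu⟩ ⟨q, hql⟩ = 1 := dist_eq_one_iff_adj.mpr hq
          omega
  · obtain ⟨w, hw⟩ := hG'.exists_walk_length_eq_dist u v
    have := dist_le (w.map (Embedding.induce (G := G) ({l}ᶜ : Set V)).toHom)
    rw [Walk.length_map] at this
    exact this.trans hw.le

/-! ### Distances and double resolution on a cycle -/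

/-- The periodic sequence `c` runs around a cycle of length `m` in `G`. -/
structure IsCyclicSequence {V : Type*} (G : SimpleGraph V) (m : ℕ) (c : ℤ → V) : Prop where
  three_le : 3 ≤ m
  eq_iff (i j : ℤ) : c i = c j ↔ (m : ℤ) ∣ i - j
  adj (i : ℤ) : G.Adj (c i) (c (i + 1))

namespace IsCyclicSequence

variable {V : Type*} {G : SimpleGraph V} {m : ℕ} {c : ℤ → V}

theorem shift (h : G.IsCyclicSequence m c) (a : ℤ) :
    G.IsCyclicSequence m (fun i ↦ c (i + a)) where
  three_le := h.three_le
  eq_iff i j := by rw [h.eq_iff]; ring_nf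
  adj i := by convert h.adj (i + a) using 2; ring

theorem ne_of_lt (h : G.IsCyclicSequence m c) {i j : ℤ} (hij : i < j) (hji : j < i + m) :
    c i ≠ c j := by
  rw [Ne, h.eq_iff]
  rintro ⟨t, ht⟩
  have hm := h.three_le
  rcases lt_or_ge t 0 with h0 | h0 <;> nlinarith

theorem adj_pred (h : G.IsCyclicSequence m c) (i : ℤ) : G.Adj (c i) (c (i - 1)) := by
  have := (h.adj (i - 1)).symm
  rwa [sub_add_cancel] at this

theorem eq_or_eq_of_adj (h : G.IsCyclicSequence m c) {i : ℤ} [Fintype (G.neighborSet (c i))]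
    (hdeg : G.degree (c i) = 2) {v : V} (hv : G.Adj (c i) v) :
    v = c (i - 1) ∨ v = c (i + 1) := by
  classical
  have hm := h.three_le
  have hne : c (i - 1) ≠ c (i + 1) := h.ne_of_lt (by omega) (by omega)
  have hsub : ({c (i - 1), c (i + 1)} : Finset V) ⊆ G.neighborFinset (c i) := by
    intro x hx
    rw [mem_neighborFinset]
    rcases Finset.mem_insert.mp hx with rfl | hx
    · exact h.adj_pred i
    · rw [Finset.mem_singleton.mp hx]; exact h.adj i
  have heq := Finset.eq_of_subset_of_card_le hsub
    (by rw [Finset.card_pair hne, card_neighborFinset_eq_degree, hdeg])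
  have : v ∈ G.neighborFinset (c i) := by simpa using hv
  rw [← heq] at this
  simpa using this

/-- If all degrees are `2`, a walk of length `n` moves by at most `n` positions. -/
theorem exists_eq_of_walk [G.LocallyFinite] (h : G.IsCyclicSequence m c)
    (hdeg : ∀ v, G.degree v = 2) {u v : V} (w : G.Walk u v) :
    ∀ i, u = c i → ∃ j, v = c j ∧ |j - i| ≤ w.length := by
  induction w with
  | nil => exact fun i hi ↦ ⟨i, hi, by simp⟩
  | cons hq w ih =>
    rintro i rfl
    rw [Walk.length_cons]
    rcases h.eq_or_eq_of_adj (hdeg _) hq with hq | hq <;>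
    · obtain ⟨j, hj, hle⟩ := ih _ hq
      refine ⟨j, hj, ?_⟩
      rw [abs_le] at hle ⊢
      push_cast
      omega

theorem exists_eq [G.LocallyFinite] (h : G.IsCyclicSequence m c) (hG : G.Connected)
    (hdeg : ∀ v, G.degree v = 2) (v : V) : ∃ i : ℤ, 0 ≤ i ∧ i < m ∧ v = c i := by
  obtain ⟨w⟩ := hG (c 0) v
  obtain ⟨j, hj, -⟩ := h.exists_eq_of_walk hdeg w 0 rfl
  have hm := h.three_le
  refine ⟨j % m, Int.emod_nonneg _ (by omega), Int.emod_lt_of_pos _ (by omega), ?_⟩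
  rw [hj, h.eq_iff]
  exact Int.dvd_self_sub_emod

theorem dist_add_le (h : G.IsCyclicSequence m c) (hG : G.Connected) (i : ℤ) (n : ℕ) :
    G.dist (c i) (c (i + n)) ≤ n := by
  induction n with
  | zero => simp
  | succ n ih =>
    have h1 := hG.dist_triangle (u := c i) (v := c (i + n)) (w := c (i + (n + 1 : ℕ)))
    have h2 : G.dist (c (i + n)) (c (i + (n + 1 : ℕ))) = 1 := by
      rw [dist_eq_one_iff_adj]
      convert h.adj (i + n) using 2
      push_cast; ring
    omega

/-- The two arcs give the upper bounds. Conversely, a geodesic lifts to positions in `ℤ`, ending at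
some `k` congruent to `j` modulo `m`; if `k ≠ j`, the lift has gone at least as far as the
complementary arc. -/
theorem dist_eq_min [G.LocallyFinite] (h : G.IsCyclicSequence m c) (hG : G.Connected)
    (hdeg : ∀ v, G.degree v = 2) {i j : ℤ} (hij : i ≤ j) (hji : j ≤ i + m) :
    (G.dist (c i) (c j) : ℤ) = min (j - i) (m - (j - i)) := by
  have h1 : (G.dist (c i) (c j) : ℤ) ≤ j - i := by
    have := h.dist_add_le hG i (j - i).toNat
    rw [show i + ((j - i).toNat : ℤ) = j by omega] at this
    omega
  have h2 : (G.dist (c i) (c j) : ℤ) ≤ m - (j - i) := by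
    have := h.dist_add_le hG j (m - (j - i)).toNat
    rw [show c (j + ((m - (j - i)).toNat : ℤ)) = c i by
      rw [h.eq_iff]; exact ⟨1, by omega⟩, dist_comm] at this
    omega
  obtain ⟨w, hw⟩ := hG.exists_walk_length_eq_dist (c i) (c j)
  obtain ⟨k, hk, hle⟩ := h.exists_eq_of_walk hdeg w i rfl
  obtain ⟨t, ht⟩ := (h.eq_iff _ _).mp hk
  rw [hw, abs_le] at hle
  rcases lt_trichotomy t 0 with h0 | rfl | h0
  · have : (m : ℤ) * t ≤ -m := by nlinarith
    omega
  · omega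
  · have : (m : ℤ) ≤ m * t := by nlinarith
    omega

/-- A cycle is doubly resolved by a given vertex with at most one further vertex if the length is
odd, and at most two further vertices if it is even. -/
theorem exists_isDoublyResolvingSet [DecidableEq V] [G.LocallyFinite]
    (h : G.IsCyclicSequence m c) (hG : G.Connected) (hdeg : ∀ v, G.degree v = 2) {W : Finset V}
    (hW : W.Nonempty) :
    ∃ S : Finset V, S.card + m % 2 ≤ 2 ∧ G.IsDoublyResolvingSet (W ∪ S) := by
  obtain ⟨a, ha⟩ := hW
  obtain ⟨i₀, -, -, rfl⟩ := h.exists_eq hG hdeg a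
  generalize hc' : (fun i ↦ c (i + i₀)) = c'
  have h' : G.IsCyclicSequence m c' := hc' ▸ h.shift i₀
  have h0 : c' 0 ∈ W := by simpa [← hc'] using ha
  have hm := h.three_le
  have dist_of (i j : ℤ) (hi : 0 ≤ i) (hi' : i < m) (hj : 0 ≤ j) (hj' : j < m) :
      (G.dist (c' i) (c' j) : ℤ) = min (max (i - j) (j - i)) (m - max (i - j) (j - i)) := by
    rcases le_total i j with hij | hij
    · rw [h'.dist_eq_min hG hdeg hij (by omega), max_eq_right (by omega)]
    · rw [dist_comm, h'.dist_eq_min hG hdeg hij (by omega), max_eq_left (by omega)]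
  -- Positions `0` and `m / 2` fail to resolve `i ≠ j` only if `i + j = m` with `m` even; for odd
  -- `m` parity forbids a tie. Position `1` breaks this mirror symmetry.
  refine ⟨if m % 2 = 0 then {c' 1, c' (m / 2 : ℕ)} else {c' (m / 2 : ℕ)}, ?_, ?_⟩
  · split_ifs with hpar
    · have := Finset.card_le_two (a := c' 1) (b := c' (m / 2 : ℕ))
      omega
    · rw [Finset.card_singleton]; omega
  intro u v huv
  obtain ⟨i, hi, hi', rfl⟩ := h'.exists_eq hG hdeg u
  obtain ⟨j, hj, hj', rfl⟩ := h'.exists_eq hG hdeg v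
  have hij : i ≠ j := fun e ↦ huv (by rw [e])
  have profile (i : ℤ) (hi : 0 ≤ i) (hi' : i < m) :
      (i ≤ (m / 2 : ℕ) ∧ G.dist (c' i) (c' 0) = i ∧
        G.dist (c' i) (c' (m / 2 : ℕ)) = (m / 2 : ℕ) - i ∧
        (0 < i → G.dist (c' i) (c' 1) = i - 1) ∧ (i = 0 → G.dist (c' i) (c' 1) = (1 : ℤ))) ∨
      ((m / 2 : ℕ) < i ∧ G.dist (c' i) (c' 0) = m - i ∧
        G.dist (c' i) (c' (m / 2 : ℕ)) = i - (m / 2 : ℕ) ∧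
        -- For odd `m` this fails at `i = m / 2 + 1`, where the other arc to `1` is shorter.
        (m % 2 = 0 → G.dist (c' i) (c' 1) = m - i + 1)) := by
    have d0 := dist_of i 0 hi hi' le_rfl (by omega)
    have d1 := dist_of i 1 hi hi' (by omega) (by omega)
    have d2 := dist_of i (m / 2 : ℕ) hi hi' (by omega) (by omega)
    rcases le_or_gt i (m / 2 : ℕ) with h | h
    · refine Or.inl ⟨h, ?_, ?_, fun h0 ↦ ?_, fun h0 ↦ ?_⟩
      · clear d1 d2; omega
      · clear d0 d1; omega
      · clear d0 d2; omega
      · clear d0 d2; omega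
    · refine Or.inr ⟨h, ?_, ?_, fun h0 ↦ ?_⟩
      · clear d1 d2; omega
      · clear d0 d1; omega
      · clear d0 d2; omega
  have pi := profile i hi hi'
  have pj := profile j hj hj'
  by_cases hres : G.DoublyResolved (c' i) (c' j) (c' 0) (c' (m / 2 : ℕ))
  · refine ⟨_, Finset.mem_union_left _ h0, _, Finset.mem_union_right _ ?_, hres⟩
    split_ifs <;> simp
  · unfold DoublyResolved at hres
    have hpar : m % 2 = 0 := by
      rcases pi with pi | pi <;> rcases pj with pj | pj <;> omega
    refine ⟨c' 0, Finset.mem_union_left _ h0, c' 1, ?_, ?_⟩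
    · simp [hpar]
    · unfold DoublyResolved
      rcases pi with pi | pi <;> rcases pj with pj | pj <;> omega

end IsCyclicSequence

/-! ### Induction by pruning leaves -/

/-- A connected graph with as many edges as vertices and no leaf has all degrees equal to `2`. -/
theorem Connected.degree_eq_two_of_card_edgeFinset {V : Type*} [Fintype V] [Nontrivial V]
    {G : SimpleGraph V} [DecidableRel G.Adj] (hG : G.Connected)
    (hcard : G.edgeFinset.card = Fintype.card V) (hleaf : ∀ v, G.degree v ≠ 1) (v : V) :
    G.degree v = 2 := by
  have hle (v : V) (_ : v ∈ Finset.univ) : 2 ≤ G.degree v := by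
    have := hG.preconnected.degree_pos_of_nontrivial v
    have := hleaf v
    omega
  have hsum := G.sum_degrees_eq_twice_card_edges
  -- All degrees are at least `2` and their average is `2`.
  have := (Finset.sum_eq_sum_iff_of_le hle).mp
    (by rw [hsum, hcard, Finset.sum_const, Finset.card_univ, smul_eq_mul, mul_comm])
  exact (this v (Finset.mem_univ v)).symm

/-- Deleting a leaf decreases the number of edges by one. -/
theorem card_edgeFinset_induce_compl_leaf {V : Type*} [Fintype V] [DecidableEq V]
    (G : SimpleGraph V) [DecidableRel G.Adj] {l : V} (hl : G.degree l = 1) :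
    (G.induce {l}ᶜ).edgeFinset.card = G.edgeFinset.card - 1 := by
  rw [card_edgeFinset_induce_compl_singleton, card_edgeFinset_deleteIncidenceSet, hl]


/-- In a connected graph with as many edges as vertices and a cycle of length `m`, any nonempty set
containing all leaves becomes doubly resolving after adding at most one vertex if `m` is odd, and at
most two vertices if `m` is even. -/
theorem Connected.exists_isDoublyResolvingSet_union {m : ℕ} :
    ∀ (n : ℕ) {V : Type*} [Fintype V] [DecidableEq V] {G : SimpleGraph V} [DecidableRel G.Adj]
      {c : ℤ → V} {W : Finset V}, Fintype.card V = n → G.Connected →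
      G.edgeFinset.card = Fintype.card V → G.IsCyclicSequence m c → W.Nonempty →
      (∀ v, G.degree v = 1 → v ∈ W) →
      ∃ S : Finset V, S.card + m % 2 ≤ 2 ∧ G.IsDoublyResolvingSet (W ∪ S) := by
  intro n
  induction n with
  | zero =>
    intro V _ _ G _ c W hn
    exact ((Fintype.card_eq_zero_iff.mp hn).false (c 0)).elim
  | succ n ih =>
    intro V _ _ G _ c W hn hG hcard hc hWne hW
    have hm := hc.three_le
    have : Nontrivial V := ⟨c 0, c 1, (hc.adj 0).ne⟩
    by_cases hleaf : ∀ v, G.degree v ≠ 1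
    · exact hc.exists_isDoublyResolvingSet hG (hG.degree_eq_two_of_card_edgeFinset hcard hleaf) hWne
    push Not at hleaf
    obtain ⟨l, hl⟩ := hleaf
    obtain ⟨p, hp, huniq⟩ := degree_eq_one_iff_existsUnique_adj.mp hl
    dsimp only at hp huniq
    have hG' := hG.induce_compl_singleton_of_degree_eq_one hl
    have hdist := hG.dist_induce_compl_leaf hp huniq hG'
    have hcl (i : ℤ) : c i ≠ l := by
      intro hi
      have h1 := huniq (c (i + 1)) (hi ▸ hc.adj i)
      have h2 := huniq (c (i - 1)) (hi ▸ hc.adj_pred i)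
      exact hc.ne_of_lt (i := i - 1) (j := i + 1) (by omega) (by omega) (h2.trans h1.symm)
    have hVcard : Fintype.card ({l}ᶜ : Set V) = n := by
      rw [Fintype.card_compl_set, hn]; simp
    let p' : ({l}ᶜ : Set V) := ⟨p, hp.ne'⟩
    -- Adding `p'` keeps the landmark set nonempty and covers the only leaf that pruning can create.
    obtain ⟨S, hS, hres⟩ := ih (G := G.induce {l}ᶜ) (c := fun i ↦ ⟨c i, hcl i⟩)
      (W := {x | x = p' ∨ (x : V) ∈ W}) hVcard hG'
      (by rw [card_edgeFinset_induce_compl_leaf G hl, hVcard, hcard, hn]; rfl)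
      ⟨hm, fun i j ↦ Subtype.ext_iff.trans (hc.eq_iff i j), fun i ↦ hc.adj i⟩
      ⟨p', by simp⟩ (by
        intro v hv
        simp only [Finset.mem_filter, Finset.mem_univ, true_and]
        by_contra! hcon
        refine hcon.2 (hW v ?_)
        rw [degree_eq_one_iff_existsUnique_adj] at hv ⊢
        obtain ⟨w, hw, hwu⟩ := hv
        refine ⟨w, hw, fun y hy ↦ ?_⟩
        have hyl : y ≠ l := by
          rintro rfl
          exact hcon.1 (Subtype.ext (huniq _ hy.symm))
        exact congrArg Subtype.val (hwu ⟨y, hyl⟩ hy))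
    refine ⟨S.map (Function.Embedding.subtype _), by rwa [Finset.card_map], ?_⟩
    set W' := W ∪ S.map (Function.Embedding.subtype _) with hW'
    have hlW' : l ∈ W' := Finset.mem_union_left _ (hW l hl)
    have hmem {x : ({l}ᶜ : Set V)}
        (hx : x ∈ ({x | x = p' ∨ (x : V) ∈ W} : Finset ({l}ᶜ : Set V)) ∪ S) :
        x = p' ∨ (x : V) ∈ W' := by
      rw [Finset.mem_union, Finset.mem_filter] at hx
      rcases hx with ⟨-, hx | hx⟩ | hx
      · exact Or.inl hx
      · exact Or.inr (Finset.mem_union_left _ hx)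
      · exact Or.inr (Finset.mem_union_right _ (Finset.mem_map_of_mem _ hx))
    have hlift {x : ({l}ᶜ : Set V)}
        (hx : x ∈ ({x | x = p' ∨ (x : V) ∈ W} : Finset ({l}ᶜ : Set V)) ∪ S) :
        ∃ z ∈ W', ∃ e : ℕ, ∀ u : ({l}ᶜ : Set V),
          G.dist u z = (G.induce {l}ᶜ).dist u x + e := by
      rcases hmem hx with rfl | hx
      · refine ⟨l, hlW', 1, fun u ↦ ?_⟩
        rw [hdist, dist_comm, hG.dist_leaf hp huniq u.2, dist_comm]
      · exact ⟨x, hx, 0, fun u ↦ by rw [hdist, add_zero]⟩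
    -- Resolving any pair takes two distinct landmarks, so not both are `p'`.
    have hother : ∃ z ∈ W', z ≠ l := by
      obtain ⟨x, hx, y, hy, hxy⟩ := hres ⟨c 0, hcl 0⟩ ⟨c 1, hcl 1⟩
        (fun h ↦ (hc.adj 0).ne (congrArg Subtype.val h))
      rcases hmem hx with rfl | hx
      · rcases hmem hy with rfl | hy
        · exact (hxy rfl).elim
        · exact ⟨y, hy, y.2⟩
      · exact ⟨x, hx, x.2⟩
    -- The difference is `d(v,p) + 1` at `l`, but at most `d(v,p) - 1` at `z` by the triangle
    -- inequality through `p`.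
    have hleafres {v : V} (hv : v ≠ l) : ∃ z ∈ W', G.DoublyResolved l v l z := by
      obtain ⟨z, hz, hzl⟩ := hother
      refine ⟨z, hz, ?_⟩
      have h1 := hG.dist_leaf hp huniq hv
      have h2 := hG.dist_leaf hp huniq hzl
      have h3 := hG.dist_triangle (u := v) (v := p) (w := z)
      rw [dist_comm] at h1
      rw [dist_comm (u := v) (v := p)] at h3
      unfold DoublyResolved
      rw [dist_self]
      omega
    intro u v huv
    by_cases hu : u = l
    · subst hu
      obtain ⟨z, hz, h⟩ := hleafres huv.symm
      exact ⟨u, hlW', z, hz, h⟩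
    by_cases hv : v = l
    · subst hv
      obtain ⟨z, hz, h⟩ := hleafres huv
      refine ⟨v, hlW', z, hz, ?_⟩
      unfold DoublyResolved at h ⊢
      omega
    obtain ⟨x, hx, y, hy, hxy⟩ := hres ⟨u, hu⟩ ⟨v, hv⟩ (fun h ↦ huv (congrArg Subtype.val h))
    obtain ⟨x', hx', e, he⟩ := hlift hx
    obtain ⟨y', hy', f, hf⟩ := hlift hy
    refine ⟨x', hx', y', hy', ?_⟩
    have h1 := he ⟨u, hu⟩
    have h2 := he ⟨v, hv⟩
    have h3 := hf ⟨u, hu⟩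
    have h4 := hf ⟨v, hv⟩
    unfold DoublyResolved at hxy ⊢
    dsimp only at h1 h2 h3 h4
    omega

/-! ### From unicyclic graphs to periodic sequences and edge counts -/

/-- Consecutive vertices of the periodic traversal of a cycle are adjacent in it. -/
theorem Walk.IsCycle.toSubgraph_adj_emod {V : Type*} {G : SimpleGraph V} {v : V} {p : G.Walk v v}
    (hp : p.IsCycle) (i : ℤ) : p.toSubgraph.Adj (p.getVert (i % p.length).toNat)
      (p.getVert ((i + 1) % p.length).toNat) := by
  have h3 := hp.three_le_length
  have hi := Int.emod_nonneg i (b := p.length) (by omega)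
  have hi' := Int.emod_lt_of_pos i (b := p.length) (by omega)
  have hadj := p.toSubgraph_adj_getVert (i := (i % p.length).toNat) (by omega)
  convert hadj using 1
  by_cases hlast : i % p.length + 1 = p.length
  · have : (i + 1) % p.length = 0 := by rw [← Int.emod_add_emod, hlast, Int.emod_self]
    rw [this, show (i % p.length).toNat + 1 = p.length by omega]
    simp
  · have : (i + 1) % p.length = i % p.length + 1 := by
      rw [← Int.emod_add_emod, Int.emod_eq_of_lt (by omega) (by omega)]
    rw [this]
    congr 1
    omega

/-- A cycle of a graph, traversed periodically. -/
theorem Walk.IsCycle.isCyclicSequence {V : Type*} {G : SimpleGraph V} {v : V} {p : G.Walk v v}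
    (hp : p.IsCycle) :
    G.IsCyclicSequence p.length (fun i ↦ p.getVert (i % p.length).toNat) where
  three_le := hp.three_le_length
  eq_iff i j := by
    have h3 := hp.three_le_length
    have hi := Int.emod_nonneg i (b := p.length) (by omega)
    have hi' := Int.emod_lt_of_pos i (b := p.length) (by omega)
    have hj := Int.emod_nonneg j (b := p.length) (by omega)
    have hj' := Int.emod_lt_of_pos j (b := p.length) (by omega)
    rw [Int.dvd_iff_emod_eq_zero, ← Int.emod_eq_emod_iff_emod_sub_eq_zero]
    refine ⟨fun h ↦ ?_, fun h ↦ by rw [h]⟩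
    have := hp.getVert_injOn' (x₁ := (i % p.length).toNat) (x₂ := (j % p.length).toNat)
      (by simp only [Set.mem_ofPred_eq]; omega) (by simp only [Set.mem_ofPred_eq]; omega) h
    omega
  adj i := (hp.toSubgraph_adj_emod i).adj_sub

theorem Walk.IsCycle.ncard_verts_toSubgraph {V : Type*} {G : SimpleGraph V} {v : V}
    {p : G.Walk v v} (hp : p.IsCycle) : p.toSubgraph.verts.ncard = p.length := by
  classical
  have h : p.toSubgraph.verts = (p.support.tail.toFinset : Set V) := by
    ext x
    have hnil := hp.not_nil
    rw [Walk.mem_verts_toSubgraph, Finset.mem_coe, List.mem_toFinset, Walk.mem_support_iff]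
    refine ⟨?_, Or.inr⟩
    rintro (rfl | h)
    · exact Walk.end_mem_tail_support hnil
    · exact h
  rw [h, Set.ncard_coe_finset, List.toFinset_card_of_nodup hp.support_nodup]
  simp

/-- A connected unicyclic graph has as many edges as vertices. -/
theorem Connected.card_edgeFinset_of_isUnicyclic {V : Type*} [Fintype V] {G : SimpleGraph V}
    [DecidableRel G.Adj] (hG : G.Connected) (huni : G.IsUnicyclic) :
    G.edgeFinset.card = Fintype.card V := by
  classical
  obtain ⟨C, ⟨v, p, hp, rfl⟩, huniq⟩ := huni
  have hadj := p.adj_snd hp.not_nil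
  have hmem : s(v, p.snd) ∈ p.edges := by
    rw [← Walk.adj_toSubgraph_iff_mem_edges]
    exact p.toSubgraph_adj_snd hp.not_nil
  -- Deleting an edge of the cycle leaves a spanning tree: the edge is no bridge, and a surviving
  -- cycle would be the unique one, which contains that edge.
  have hconn : (G.deleteEdges {s(v, p.snd)}).Connected :=
    hG.connected_delete_edge_of_not_isBridge fun h ↦ (IsBridge.notMem_edges_of_isCycle h hp) hmem
  have hacyc : (G.deleteEdges {s(v, p.snd)}).IsAcyclic := by
    intro w q hq
    have hle := G.deleteEdges_le {s(v, p.snd)}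
    have heq := huniq _ ⟨w, q.mapLe hle, hq.mapLe hle, rfl⟩
    rw [← Walk.adj_toSubgraph_iff_mem_edges, ← heq, Walk.adj_toSubgraph_iff_mem_edges,
      Walk.edges_mapLe_eq_edges] at hmem
    have := q.edges_subset_edgeSet hmem
    simp at this
  have htree := IsTree.card_edgeFinset ⟨hconn, hacyc⟩
  have hdel : (G.deleteEdges {s(v, p.snd)}).edgeFinset = G.edgeFinset.erase s(v, p.snd) := by
    ext e
    simp [and_comm]
  rw [hdel, Finset.card_erase_add_one (by simpa using hadj)] at htree
  exact htree

/-- A connected graph with all degrees equal to `2` that contains a cycle is a cycle. -/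
theorem Connected.isCycleGraph_of_degree_eq_two {V : Type*} {G : SimpleGraph V}
    [G.LocallyFinite] (hG : G.Connected) (hdeg : ∀ v, G.degree v = 2) {v : V} {p : G.Walk v v}
    (hp : p.IsCycle) : G.IsCycleGraph := by
  have hc := hp.isCyclicSequence
  refine ⟨v, p, hp, ?_⟩
  ext x y
  · obtain ⟨i, -, -, rfl⟩ := hc.exists_eq hG hdeg x
    simp
  · refine ⟨fun h ↦ h.adj_sub, fun h ↦ ?_⟩
    obtain ⟨i, -, -, rfl⟩ := hc.exists_eq hG hdeg x
    rcases hc.eq_or_eq_of_adj (hdeg _) h with rfl | rfl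
    · simpa using (hp.toSubgraph_adj_emod (i - 1)).symm
    · exact hp.toSubgraph_adj_emod i

end SimpleGraph

theorem mainTheorem3 {V : Type*} [Fintype V] (G : SimpleGraph V) [DecidableRel G.Adj]
    (hconn : G.Connected) (huni : G.IsUnicyclic) (hnot : ¬ G.IsCycleGraph)
    (C : G.Subgraph) (hC : C.IsCycleSubgraph) (m : ℕ) (hm : C.verts.ncard = m) :
    G.leafFinset.card ≤ G.doublyResolvingNumber ∧
      (Odd m → G.doublyResolvingNumber ≤ G.leafFinset.card + 1) ∧
      (Even m → G.doublyResolvingNumber ≤ G.leafFinset.card + 2) := by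
  classical
  constructor
  · obtain ⟨W, hW, hcard⟩ := hconn.exists_card_eq_doublyResolvingNumber
    rw [← hcard]
    refine Finset.card_le_card fun l hl ↦ hW.mem_of_degree_eq_one hconn ?_
    simpa [SimpleGraph.leafFinset] using hl
  obtain ⟨v, p, hp, rfl⟩ := hC
  rw [hp.ncard_verts_toSubgraph] at hm
  have hcard := hconn.card_edgeFinset_of_isUnicyclic huni
  have : Nontrivial V := ⟨v, p.snd, (p.adj_snd hp.not_nil).ne⟩
  -- Without leaves all degrees would be `2` and `G` would be a cycle; a leaf supplies the free
  -- landmark.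
  have hne : G.leafFinset.Nonempty := by
    by_contra hemp
    refine hnot (hconn.isCycleGraph_of_degree_eq_two
      (hconn.degree_eq_two_of_card_edgeFinset hcard fun l hl ↦ hemp ⟨l, ?_⟩) hp)
    simpa [SimpleGraph.leafFinset] using hl
  obtain ⟨S, hS, hres⟩ := hconn.exists_isDoublyResolvingSet_union _ rfl hcard
    hp.isCyclicSequence hne (fun l hl ↦ by simpa [SimpleGraph.leafFinset] using hl)
  have hle : G.doublyResolvingNumber ≤ G.leafFinset.card + S.card :=
    (Nat.sInf_le (by exact ⟨_, hres, rfl⟩)).trans (Finset.card_union_le _ _)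
  rw [hm] at hS
  exact ⟨fun h ↦ by have := Nat.odd_iff.mp h; omega, fun _ ↦ by omega⟩
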